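/- **Setting.** A network consists of a directed acyclic (multi)graph with links $e\in\mathcal E$, each with a tail and a head node ($\mathcal E$ finite), a finite set $\mathcal S$ of sessions, a source node $a(s)$ and a non-empty finite set $b(s)$ of sink nodes for every $s\in\mathcal S$, and real link capacities $C_e$. We write $v\to e$ if $v$ is the tail of $e$, $e\to v$ if $v$ is the head of $e$, and $f\to e$ if the head of $f$ is the tail of $e$. A function $h$ on the subsets of a finite set is *polymatroidal* ($h\in\Gamma$) if $h(\emptyset)=0$ and $h$ is non-decreasing and submodular; $h(\mathcal B\mid\mathcal A)=h(\mathcal A\cup\mathcal B)-h(\mathcal A)$. For $h$ on the subsets of the pseudo-variables $\{Y_s\}_{s\in\mathcal S}\cup\{U_e\}_{e\in\mathcal E}$ consider - $\mathcal C_1$: $h(Y_{\mathcal S})=\sum_{s\in\mathcal S}h(Y_s)$; - $\mathcal C_2$: $h(U_e\mid\{Y_s:a(s)\to e\},\{U_f:f\to e\})=0$ for all $e$; - $\mathcal C_3$: $h(Y_s\mid U_e:e\to u)=0$ for all $s$ and all $u\in b(s)$; - $\mathcal C_4$: $h(U_e)\le C_e$ for all $e$. **Construction-B.** The directed graph $\mathcal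 G$ has the nodes $Y_s$, $U_e$ and $\hat Y^i_s$ ($i\in b(s)$, the estimates), and the edges $Y_s\to U_e$ if $a(s)\to e$; $U_f\to U_e$ if $f\to e$; $U_e\to\hat Y^i_s$ if $e\to i$; and $\hat Y^i_s\to Y_s$. For a subgraph, the bar denotes removal of all edges that enter some $Y_s$. **The closure $\psi$.** For a set $\mathcal A$ of nodes, remove from $\mathcal G$ all edges outgoing from $\mathcal A$. Then, as long as possible, (1) delete nodes that have no incoming edge or no node $Y_t$ as an ancestor in the current graph $\mathcal G^*$ (deleting a node deletes its edges); (2) if for some $s$ and some $i\in b(s)$ the nodes $Y_s$ and $\hat Y_s^i$ are not joined by an undirected path (in particular if one of them has been deleted) in the ancestral graph $\bar{\mathcal G}^*_{An(Y_s,\hat Y_s^i,\mathcal A)}$, i.e. the subgraph of $\bar{\mathcal G}^*$ induced by the remaining nodes among $Y_s,\hat Y_s^i,\mathcal A$ and all their ancestors in $\bar{\mathcal G}^*$, delete $\hat Y^j_s$ for all $j\in b(s)$. The result does not depend on the order; $\psi(\mathcal A)$ is the set of deleted nodes. Write $\mathcal A\twoheadrightarrow\mathcal B$ if $\mathcal B\subseteq\psi(\mathcal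 A)$. A set $\mathcal B$ is *irreducible* if no proper subset $\mathcal A\subsetneq\mathcal B$ satisfies $\mathcal A\twoheadrightarrow\mathcal B\setminus\mathcal A$; an irreducible set $\mathcal A$ is *maximal* if $\psi(\mathcal A)$ consists of all nodes and no proper subset of $\mathcal A$ has this property. Let $\boldsymbol{\mathcal M}$ be the collection of all maximal irreducible sets. **Theorem.** For every such network: (i) Let $h$ be polymatroidal on the subsets of the node set of $\mathcal G$, such that every node is a function of its parents ($h(v\mid\text{parents of }v)=0$), $h(Y_s\mid\hat Y_s^i)=h(\hat Y_s^i\mid Y_s)=0$ for all $s$ and $i\in b(s)$, and $h(Y_{\mathcal S})=\sum_s h(Y_s)$. Then $\mathcal A\twoheadrightarrow\mathcal B$ implies $h(\mathcal B\mid\mathcal A)=0$ for all sets $\mathcal A,\mathcal B$ of nodes (disjoint or not). (ii) Let $h\in\mathcal C_1\cap\mathcal C_2\cap\mathcal C_3\cap\mathcal C_4\cap\Gamma$. Then for every $\mathcal W\subseteq\mathcal S$, with $\mathcal W^c=\mathcal S\setminus\mathcal W$, $$h(Y_{\mathcal W}\mid Y_{\mathcal W^c})\le\min_{\{U_{\mathcal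 A},Y_{\mathcal W^c}\}\in\boldsymbol{\mathcal M}}\sum_{e\in\mathcal A}C_e\qquad\text{and}\qquad\sum_{s\in\mathcal W}h(Y_s)\le\min_{\{U_{\mathcal A},Y_{\mathcal W^c}\}\in\boldsymbol{\mathcal M}}\sum_{e\in\mathcal A}C_e ,$$ where the minimum runs over the sets $\mathcal A\subseteq\mathcal E$ of links for which $\{U_{\mathcal A},Y_{\mathcal W^c}\}\in\boldsymbol{\mathcal M}$, and is $+\infty$ if there are none. (iii) Consequently the linear programming region $\mathcal R(\Gamma)$ of all $R\in\mathbb R_+^{\mathcal S}$ for which some $h\in\mathcal C_1\cap\mathcal C_2\cap\mathcal C_3\cap\mathcal C_4\cap\Gamma$ has $R_s\le h(Y_s)$ for all $s$ is contained in $$\mathcal R_\perp=\bigcap_{\mathcal W\subseteq\mathcal S}\Big\{R\in\mathbb R_+^{\mathcal S}:\ \sum_{s\in\mathcal W}R_s\le\min_{\{U_{\mathcal A},Y_{\mathcal W^c}\}\in\boldsymbol{\mathcal M}}\sum_{e\in\mathcal A}C_e\Big\}.$$ -/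

import Mathlib

/-! ### Pseudo-entropy functions -/

/-- Polymatroidal functions on the subsets of a ground set `X` (the cone `Γ`). -/
structure IsPolymatroid {X : Type*} (h : Set X → ℝ) : Prop where
  empty : h ∅ = 0
  mono : ∀ A B : Set X, B ⊆ A → h B ≤ h A
  submodular : ∀ A B : Set X, h (A ∪ B) + h (A ∩ B) ≤ h A + h B

/-- Conditional pseudo-entropy `h(B ∣ A) = h(A ∪ B) - h(A)`. -/
def condEntropy {X : Type*} (h : Set X → ℝ) (B A : Set X) : ℝ := h (A ∪ B) - h A

/-! ### Networks -/

/-- A communication network: a directed acyclic (multi)graph with nodes `V` and links `E`, and a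
set `S` of sessions; session `s` is available at the node `a s` and is demanded by the
nodes in the non-empty finite set `b s`. -/
structure Network (V E S : Type*) where
  tail : E → V
  head : E → V
  acyclic : ∀ v : V, ¬ Relation.TransGen (fun u w => ∃ e : E, tail e = u ∧ head e = w) v v
  a : S → V
  b : S → Finset V
  demanded : ∀ s, (b s).Nonempty

namespace Network

/-- Source independence; `Sum.inl s` stands for `Y_s`, `Sum.inr e` for `U_e`. -/
def C1 {V E S : Type*} [Fintype S] (_N : Network V E S) (h : Set (S ⊕ E) → ℝ) : Prop :=
  h (Set.range Sum.inl) = ∑ s, h {Sum.inl s}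

/-- Network coding constraints `h(U_e ∣ {Y_s : a(s) → e}, {U_f : f → e}) = 0`. -/
def C2 {V E S : Type*} (N : Network V E S) (h : Set (S ⊕ E) → ℝ) : Prop :=
  ∀ e : E, condEntropy h {Sum.inr e}
    (Sum.inl '' {s | N.a s = N.tail e} ∪ Sum.inr '' {f | N.head f = N.tail e}) = 0

/-- Decoding constraints `h(Y_s ∣ U_e : e → u) = 0` for `u ∈ b(s)`. -/
def C3 {V E S : Type*} (N : Network V E S) (h : Set (S ⊕ E) → ℝ) : Prop :=
  ∀ s : S, ∀ u ∈ N.b s, condEntropy h {Sum.inl s} (Sum.inr '' {e | N.head e = u}) = 0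

/-- Capacity constraints `h(U_e) ≤ C_e`. -/
def C4 {V E S : Type*} (_N : Network V E S) (C : E → ℝ) (h : Set (S ⊕ E) → ℝ) : Prop :=
  ∀ e : E, h {Sum.inr e} ≤ C e

/-- The linear programming region `R(Γ)` for independent sources. -/
def lpRegion {V E S : Type*} [Fintype S] (N : Network V E S) (C : E → ℝ) : Set (S → ℝ) :=
  {R | (∀ s, 0 ≤ R s) ∧ ∃ h : Set (S ⊕ E) → ℝ,
    IsPolymatroid h ∧ N.C1 h ∧ N.C2 h ∧ N.C3 h ∧ N.C4 C h ∧ ∀ s, R s ≤ h {Sum.inl s}}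

/-! ### Construction-B -/

/-- Nodes of the Construction-B functional dependence graph: `Y_s`, `U_e`, and the
estimates `Ŷ_s^i`, `i ∈ b(s)`. -/
inductive Node {V E S : Type*} (N : Network V E S) : Type _
  | source (s : S) : Node N
  | link (e : E) : Node N
  | estimate (s : S) (i : {i // i ∈ N.b s}) : Node N

/-- Edges of the Construction-B functional dependence graph. -/
inductive FEdge {V E S : Type*} (N : Network V E S) : N.Node → N.Node → Prop
  | encodeSource (s : S) (e : E) : N.a s = N.tail e → FEdge N (.source s) (.link e)
  | encodeLink (f e : E) : N.head f = N.tail e → FEdge N (.link f) (.link e)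
  | decode (e : E) (s : S) (i : {i // i ∈ N.b s}) :
      N.head e = i.1 → FEdge N (.link e) (.estimate s i)
  | identify (s : S) (i : {i // i ∈ N.b s}) : FEdge N (.estimate s i) (.source s)

/-- `h` is a pseudo-entropy function on the nodes of the Construction-B graph of a network with
independent sources: every node is a function of its parents, all estimates of a source agree
with the source, and the sources are independent. -/
structure IsConstructionB {V E S : Type*} [Fintype S] (N : Network V E S)
    (h : Set N.Node → ℝ) : Prop where
  localDependence : ∀ v : N.Node, condEntropy h {v} {u | N.FEdge u v} = 0
  source_of_estimate : ∀ s i, condEntropy h {Node.source s} {Node.estimate s i} = 0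
  estimate_of_source : ∀ s i, condEntropy h {Node.estimate s i} {Node.source s} = 0
  independent : h (Set.range Node.source) = ∑ s, h {Node.source s}

/-! ### The closure `ψ`

Throughout, `A` is the given set of nodes (its outgoing edges are removed) and `D` is the set of
nodes that have been deleted so far. -/

/-- Edges of the current graph `G*`. -/
def StarEdge {V E S : Type*} (N : Network V E S) (A D : Set N.Node) (u v : N.Node) : Prop :=
  N.FEdge u v ∧ u ∉ A ∧ u ∉ D ∧ v ∉ D

/-- Edges of `Ḡ*`: the edges of `G*` that do not enter a source node. -/
def BarEdge {V E S : Type*} (N : Network V E S) (A D : Set N.Node) (u v : N.Node) : Prop :=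
  N.StarEdge A D u v ∧ v ∉ Set.range (Node.source (N := N))

/-- Nodes of the ancestral graph of `Ḡ*` with respect to `T`. -/
def ancestral {V E S : Type*} (N : Network V E S) (A D T : Set N.Node) : Set N.Node :=
  {u | u ∉ D ∧ ∃ t ∈ T, t ∉ D ∧ Relation.ReflTransGen (N.BarEdge A D) u t}

/-- `Y_s` and `Ŷ_s^i` are both present and are connected, in the undirected sense, in the
ancestral graph of `Ḡ*` with respect to `{Y_s, Ŷ_s^i} ∪ A`. -/
def Linked {V E S : Type*} (N : Network V E S) (A D : Set N.Node) (s : S)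
    (i : {i // i ∈ N.b s}) : Prop :=
  Node.source s ∉ D ∧ Node.estimate s i ∉ D ∧
    Relation.EqvGen (fun u v => N.BarEdge A D u v ∧
        u ∈ N.ancestral A D ({Node.source s, Node.estimate s i} ∪ A) ∧
        v ∈ N.ancestral A D ({Node.source s, Node.estimate s i} ∪ A))
      (Node.source s) (Node.estimate s i)

/-- `Deleted A D`: the removal procedure started from `A` can reach a stage in which `D` is
the set of deleted nodes. -/
inductive Deleted {V E S : Type*} (N : Network V E S) (A : Set N.Node) : Set N.Node → Prop
  | start : Deleted N A ∅
  /-- delete a node without incoming edges -/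
  | noIncoming (D : Set N.Node) (v : N.Node) : Deleted N A D →
      (∀ u, ¬ N.StarEdge A D u v) → Deleted N A (insert v D)
  /-- delete a node without source nodes as ancestors -/
  | noSource (D : Set N.Node) (v : N.Node) : Deleted N A D →
      (∀ s, ¬ Relation.TransGen (N.StarEdge A D) (Node.source s) v) → Deleted N A (insert v D)
  /-- delete all estimates of `Y_s` if one of them is disconnected from `Y_s` -/
  | separated (D : Set N.Node) (s : S) (i : {i // i ∈ N.b s}) : Deleted N A D →
      ¬ N.Linked A D s i → Deleted N A (D ∪ Set.range (Node.estimate s))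

/-- `ψ(A)`: the nodes deleted by the procedure. The order of the deletions is immaterial, and
`ψ(A)` is itself the stage at which the procedure stops; see `deleted_psi` and `psi_final`. -/
def psi {V E S : Type*} (N : Network V E S) (A : Set N.Node) : Set N.Node :=
  {v | ∃ D, N.Deleted A D ∧ v ∈ D}

/-- `A` determines `B`, written `A ↠ B`. -/
def Determines {V E S : Type*} (N : Network V E S) (A B : Set N.Node) : Prop := B ⊆ N.psi A

/-- `B` is irreducible: no proper subset determines the rest of `B`. -/
def Irreducible {V E S : Type*} (N : Network V E S) (B : Set N.Node) : Prop :=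
  ¬ ∃ A, A ⊂ B ∧ N.Determines A (B \ A)

/-- Maximal irreducible sets for independent sources. -/
def MaximalIrreducible {V E S : Type*} (N : Network V E S) (A : Set N.Node) : Prop :=
  N.Irreducible A ∧ (Set.univ \ N.psi A = ∅) ∧
    ∀ A', A' ⊂ A → ¬ (Set.univ \ N.psi A' = ∅)

/-- The set of nodes `{U_A, Y_{Wᶜ}}`. -/
def cutNodes {V E S : Type*} (N : Network V E S) (A : Finset E) (W : Finset S) : Set N.Node :=
  Node.link '' (A : Set E) ∪ Node.source '' ((W : Set S)ᶜ)

/-- `min ∑_{e ∈ A} C_e` over the maximal irreducible sets of the form `{U_A, Y_{Wᶜ}}`,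
with value `+∞` if there is none. -/
noncomputable def minCut {V E S : Type*} (N : Network V E S) (C : E → ℝ) (W : Finset S) : EReal :=
  ⨅ (A : Finset E) (_ : N.MaximalIrreducible (N.cutNodes A W)), ((∑ e ∈ A, C e : ℝ) : EReal)

/-- The region `R_⊥`. -/
def regionPerp {V E S : Type*} (N : Network V E S) (C : E → ℝ) : Set (S → ℝ) :=
  {R | (∀ s, 0 ≤ R s) ∧ ∀ W : Finset S, ((∑ s ∈ W, R s : ℝ) : EReal) ≤ N.minCut C W}

/-! ### The procedure is well defined -/

theorem StarEdge.anti {V E S : Type*} {N : Network V E S} {A D D' : Set N.Node} (hD : D ⊆ D')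
    {u v : N.Node} (h : N.StarEdge A D' u v) : N.StarEdge A D u v :=
  ⟨h.1, h.2.1, fun hu => h.2.2.1 (hD hu), fun hv => h.2.2.2 (hD hv)⟩

theorem Linked.anti {V E S : Type*} {N : Network V E S} {A D D' : Set N.Node} (hD : D ⊆ D')
    {s : S} {i : {i // i ∈ N.b s}} (h : N.Linked A D' s i) : N.Linked A D s i := by
  have hbar : ∀ u v, N.BarEdge A D' u v → N.BarEdge A D u v :=
    fun u v huv => ⟨huv.1.anti hD, huv.2⟩
  have hanc : ∀ T, N.ancestral A D' T ⊆ N.ancestral A D T := by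
    rintro T u ⟨hu, t, ht, htD, hp⟩
    exact ⟨fun k => hu (hD k), t, ht, fun k => htD (hD k), Relation.ReflTransGen.mono hbar _ _ hp⟩
  exact ⟨fun k => h.1 (hD k), fun k => h.2.1 (hD k),
    h.2.2.mono fun u v huv => ⟨hbar u v huv.1, hanc _ huv.2.1, hanc _ huv.2.2⟩⟩

theorem Deleted.union {V E S : Type*} {N : Network V E S} {A D D' : Set N.Node}
    (h : N.Deleted A D) (h' : N.Deleted A D') : N.Deleted A (D ∪ D') := by
  induction h' with
  | start => simpa using h
  | noIncoming D' v _ hv ih =>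
    rw [Set.union_insert]
    exact ih.noIncoming _ v fun u hu => hv u (hu.anti Set.subset_union_right)
  | noSource D' v _ hv ih =>
    rw [Set.union_insert]
    exact ih.noSource _ v fun s hs =>
      hv s (Relation.TransGen.mono
        (fun _ _ k => StarEdge.anti Set.subset_union_right k) _ _ hs)
  | separated D' s i _ hs ih =>
    rw [← Set.union_assoc]
    exact ih.separated _ s i fun k => hs (k.anti Set.subset_union_right)

instance finiteNode {V E S : Type*} [Finite E] [Finite S] (N : Network V E S) :
    Finite N.Node := by
  let g : S ⊕ E ⊕ (Σ s : S, {i // i ∈ N.b s}) → N.Node := fun x =>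
    match x with
    | .inl s => .source s
    | .inr (.inl e) => .link e
    | .inr (.inr p) => .estimate p.1 p.2
  refine Finite.of_surjective g ?_
  rintro (s | e | ⟨s, i⟩)
  · exact ⟨.inl s, rfl⟩
  · exact ⟨.inr (.inl e), rfl⟩
  · exact ⟨.inr (.inr ⟨s, i⟩), rfl⟩

/-- `ψ(A)` is itself a stage of the procedure. -/
theorem deleted_psi {V E S : Type*} [Finite E] [Finite S] (N : Network V E S) (A : Set N.Node) :
    N.Deleted A (N.psi A) := by
  have key : ∀ T : Set N.Node, T.Finite → T ⊆ N.psi A → ∃ D, N.Deleted A D ∧ T ⊆ D := by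
    intro T hT
    refine Set.Finite.induction_on _ hT (fun _ => ⟨∅, .start, subset_rfl⟩) ?_
    intro v T' _ _ ih hsub
    obtain ⟨D, hD, hTD⟩ := ih (fun x hx => hsub (Set.mem_insert_of_mem _ hx))
    obtain ⟨D', hD', hv⟩ := hsub (Set.mem_insert v T')
    exact ⟨D ∪ D', hD.union hD', Set.insert_subset (Or.inr hv)
      (hTD.trans Set.subset_union_left)⟩
  obtain ⟨D, hD, hsub⟩ := key (N.psi A) (Set.toFinite _) subset_rfl
  have : N.psi A = D := Set.Subset.antisymm hsub fun v hv => ⟨D, hD, hv⟩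
  rw [this]
  exact hD

/-- No rule of the procedure deletes any further node once `ψ(A)` has been deleted. -/
theorem psi_final {V E S : Type*} [Finite E] [Finite S] (N : Network V E S) (A : Set N.Node) :
    (∀ v ∉ N.psi A, (∃ u, N.StarEdge A (N.psi A) u v) ∧
      ∃ s, Relation.TransGen (N.StarEdge A (N.psi A)) (Node.source s) v) ∧
    ∀ s, (∃ i, ¬ N.Linked A (N.psi A) s i) → ∀ j, Node.estimate s j ∈ N.psi A := by
  have hd := N.deleted_psi A
  refine ⟨fun v hv => ⟨?_, ?_⟩, ?_⟩
  · by_contra hc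
    push Not at hc
    exact hv ⟨_, hd.noIncoming _ v hc, Set.mem_insert _ _⟩
  · by_contra hc
    push Not at hc
    exact hv ⟨_, hd.noSource _ v hc, Set.mem_insert _ _⟩
  · rintro s ⟨i, hi⟩ j
    exact ⟨_, hd.separated _ s i hi, Or.inr ⟨j, rfl⟩⟩

end Network

/-! ### Closure and conditional independence for polymatroids -/

/-! Part (i) is the claim that the deletion procedure is sound: everything it deletes lies in the
closure of `A` under `h`. The crux is rule (2), `source_mem_of_not_linked`. Split the sources into
those in the component of `Y_s` in the ancestral graph and the others. Given the deleted sources,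
the two families are independent. Each node of `A`, taken in topological order, is a function of one
side and the earlier nodes of `A`, so independence survives conditioning on `A`. Now `Y_s` lies on
one side and is a function of its estimate on the other, hence of the condition, hence of `A`.

This needs deleted nodes to be computable in topological order, not merely to lie in the closure of
`A`; that is the invariant `Supported`. Since a stage itself may violate it,
`exists_supported_of_deleted` carries a larger set.

For (ii), identifying each estimate with its source turns `h` into a function to which (i) applies;
a set determining everything then bounds `h(Y_S)` by subadditivity. Part (iii) is immediate from
this. -/

/-- The elements determined by `A` under the polymatroid `h`. -/
def polyClosure {X : Type*} (h : Set X → ℝ) (A : Set X) : Set X := {v | h (insert v A) = h A}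

namespace IsPolymatroid

variable {X : Type*} {h : Set X → ℝ}

theorem subset_polyClosure (A : Set X) : A ⊆ polyClosure h A := fun v hv => by
  simp [polyClosure, Set.insert_eq_of_mem hv]

theorem polyClosure_mono (hh : IsPolymatroid h) {A B : Set X} (hAB : A ⊆ B) :
    polyClosure h A ⊆ polyClosure h B := fun v (hv : h (insert v A) = h A) => by
  have h1 := hh.submodular B (insert v A)
  have h2 : B ∪ insert v A = insert v B := by
    rw [Set.union_insert, Set.union_eq_self_of_subset_right hAB]
  have h3 := hh.mono (B ∩ insert v A) A (Set.subset_inter hAB (Set.subset_insert _ _))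
  rw [h2] at h1
  have h4 := hh.mono (insert v B) B (Set.subset_insert _ _)
  exact le_antisymm (by linarith) h4

theorem union_eq_of_subset_polyClosure [Finite X] (hh : IsPolymatroid h) {A B : Set X}
    (hB : B ⊆ polyClosure h A) : h (A ∪ B) = h A := by
  induction B, Set.toFinite B using Set.Finite.induction_on with
  | empty => simp
  | @insert v B _ _ ih =>
    have h1 : v ∈ polyClosure h (A ∪ B) :=
      hh.polyClosure_mono Set.subset_union_left (hB (Set.mem_insert _ _))
    rw [Set.union_insert, ← ih fun x hx => hB (Set.mem_insert_of_mem _ hx)]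
    exact h1

theorem condEntropy_eq_zero_iff [Finite X] (hh : IsPolymatroid h) {A B : Set X} :
    condEntropy h B A = 0 ↔ B ⊆ polyClosure h A := by
  refine ⟨fun h0 v hv => ?_, fun hB => ?_⟩
  · have h1 := hh.mono (A ∪ B) (insert v A)
      (Set.insert_subset (Or.inr hv) Set.subset_union_left)
    have h2 := hh.mono (insert v A) A (Set.subset_insert _ _)
    simp only [condEntropy] at h0
    exact le_antisymm (by linarith) h2
  · rw [condEntropy, hh.union_eq_of_subset_polyClosure hB, sub_self]

theorem polyClosure_trans [Finite X] (hh : IsPolymatroid h) {A B : Set X}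
    (hB : B ⊆ polyClosure h A) : polyClosure h B ⊆ polyClosure h A := fun v hv => by
  have h1 : h (insert v (A ∪ B)) = h (A ∪ B) := hh.polyClosure_mono Set.subset_union_right hv
  rw [hh.union_eq_of_subset_polyClosure hB] at h1
  have h2 := hh.mono (insert v (A ∪ B)) (insert v A)
    (Set.insert_subset_insert Set.subset_union_left)
  have h3 := hh.mono (insert v A) A (Set.subset_insert _ _)
  exact le_antisymm (by linarith) h3

/-- If `P` and `R` are conditionally independent given `Z`, they remain so when a function of `P`
is added to all three sets. -/
theorem condIndep_union [Finite X] (hh : IsPolymatroid h) {P R Z B : Set X} (hZR : Z ⊆ R)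
    (hi : h P + h R ≤ h (P ∪ R) + h Z) (hB : B ⊆ polyClosure h P) :
    h (P ∪ B) + h (R ∪ B) ≤ h ((P ∪ B) ∪ (R ∪ B)) + h (Z ∪ B) := by
  have h1 := hh.union_eq_of_subset_polyClosure hB
  have h2 := hh.mono ((P ∪ B) ∪ (R ∪ B)) (P ∪ R)
    (Set.union_subset_union Set.subset_union_left Set.subset_union_left)
  -- Adding `B` raises `h` over `R` by at most as much as over `Z`, and over `P` not at all.
  have h3 := hh.submodular R (Z ∪ B)
  have h4 : R ∪ (Z ∪ B) = R ∪ B := by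
    rw [← Set.union_assoc, Set.union_eq_self_of_subset_right hZR]
  have h5 := hh.mono (R ∩ (Z ∪ B)) Z (Set.subset_inter hZR Set.subset_union_left)
  rw [h4] at h3
  linarith

/-- A common function of conditionally independent sets is a function of the condition. -/
theorem mem_polyClosure_of_condIndep (hh : IsPolymatroid h) {P R Z : Set X} (hZP : Z ⊆ P)
    (hZR : Z ⊆ R) (hi : h P + h R ≤ h (P ∪ R) + h Z) {y : X} (hP : y ∈ P)
    (hR : y ∈ polyClosure h R) : y ∈ polyClosure h Z := by
  have h1 : h (insert y R) = h R := hR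
  have h2 := hh.submodular P (insert y R)
  have h3 := hh.mono (P ∪ insert y R) (P ∪ R)
    (Set.union_subset_union_right _ (Set.subset_insert _ _))
  have h4 := hh.mono (P ∩ insert y R) (insert y Z)
    (Set.subset_inter (Set.insert_subset hP hZP) (Set.insert_subset_insert hZR))
  have h5 := hh.mono (insert y Z) Z (Set.subset_insert _ _)
  exact le_antisymm (by linarith) h5

/-! ### Independent families -/

theorem image_finset_le_sum (hh : IsPolymatroid h) {I : Type*} (f : I → X) (W : Finset I) :
    h (f '' (W : Set I)) ≤ ∑ s ∈ W, h {f s} := by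
  classical
  induction W using Finset.induction_on with
  | empty => simp [hh.empty]
  | insert s W hs ih =>
    rw [Finset.sum_insert hs, Finset.coe_insert, Set.image_insert_eq, Set.insert_eq]
    have h1 := hh.submodular {f s} (f '' (W : Set I))
    have h2 := hh.mono ({f s} ∩ f '' (W : Set I)) ∅ (Set.empty_subset _)
    rw [hh.empty] at h2
    linarith

theorem image_finset_eq_sum (hh : IsPolymatroid h) {I : Type*} [Fintype I] (f : I → X)
    (hi : h (Set.range f) = ∑ s, h {f s}) (W : Finset I) :
    h (f '' (W : Set I)) = ∑ s ∈ W, h {f s} := by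
  classical
  refine le_antisymm (hh.image_finset_le_sum f W) ?_
  -- Subadditivity on `W` and on its complement must both be tight, since the total is.
  have h1 := hh.image_finset_le_sum f Wᶜ
  have h2 := hh.submodular (f '' (W : Set I)) (f '' ((Wᶜ : Finset I) : Set I))
  have h3 := hh.mono (f '' (W : Set I) ∩ f '' ((Wᶜ : Finset I) : Set I)) ∅ (Set.empty_subset _)
  have h4 : f '' (W : Set I) ∪ f '' ((Wᶜ : Finset I) : Set I) = Set.range f := by
    rw [← Set.image_union, Finset.coe_compl, Set.union_compl_self, Set.image_univ]
  rw [hh.empty] at h3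
  rw [h4, hi, ← Finset.sum_add_sum_compl W] at h2
  linarith

/-- Disjoint families of independent variables are independent given any further variables. -/
theorem condIndep_of_independent (hh : IsPolymatroid h) {I : Type*} [Fintype I] (f : I → X)
    (hi : h (Set.range f) = ∑ s, h {f s}) (K Q : Set I) :
    h (f '' K ∪ f '' Q) + h (f '' Kᶜ ∪ f '' Q) ≤
      h ((f '' K ∪ f '' Q) ∪ (f '' Kᶜ ∪ f '' Q)) + h (f '' Q) := by
  classical
  have key : ∀ T : Set I, h (f '' T) = ∑ s ∈ T.toFinset, h {f s} := fun T => by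
    rw [← hh.image_finset_eq_sum f hi, Set.coe_toFinset]
  rw [← Set.image_union, ← Set.image_union, ← Set.image_union, key, key, key, key,
    Set.toFinset_union (K ∪ Q), ← Finset.sum_union_inter]
  refine le_of_eq ?_
  congr 2 <;> ext x <;>
    simp only [Finset.mem_union, Finset.mem_inter, Set.mem_toFinset, Set.mem_union,
      Set.mem_compl_iff] <;> tauto

end IsPolymatroid

namespace Network

variable {V E S : Type*} {N : Network V E S}

/-! ### A topological order of the graph without the edges into source nodes -/

/-- Count the strict ancestors of a link: `f` is an ancestor of `e` but, by acyclicity, not of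
itself. -/
theorem exists_link_rank [Finite E] (N : Network V E S) :
    ∃ r : E → ℕ, ∀ f e, N.head f = N.tail e → r f < r e := by
  let R : E → E → Prop := fun f e => N.head f = N.tail e
  refine ⟨fun e => {f | Relation.TransGen R f e}.ncard, fun f e hfe => ?_⟩
  refine Set.ncard_lt_ncard ⟨fun g hg => hg.tail hfe, fun hsub => ?_⟩ (Set.toFinite _)
  have hf : Relation.TransGen R f f := hsub (Relation.TransGen.single hfe)
  exact N.acyclic (N.tail f) (Relation.TransGen.lift (r := R) N.tail (fun a _ hab => ⟨a, rfl, hab⟩) _ _ hf)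

theorem exists_rank [Finite E] (N : Network V E S) :
    ∃ r : N.Node → ℕ, ∀ u v, N.FEdge u v → v ∉ Set.range (Node.source (N := N)) → r u < r v := by
  obtain ⟨r, hr⟩ := N.exists_link_rank
  cases nonempty_fintype E
  refine ⟨fun v => match v with
    | .source _ => 0
    | .link e => r e + 1
    -- The sum dominates every `r e`, so estimates come after all links.
    | .estimate _ _ => (∑ e, r e) + 2, ?_⟩
  rintro _ _ (⟨s, e, h⟩ | ⟨f, e, h⟩ | ⟨e, s, i, h⟩ | ⟨s, i⟩) hv
  · exact Nat.succ_pos _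
  · exact Nat.succ_lt_succ (hr f e h)
  · have := Finset.single_le_sum (f := r) (fun _ _ => Nat.zero_le _) (Finset.mem_univ e)
    show r e + 1 < (∑ e, r e) + 2
    omega
  · exact absurd ⟨s, rfl⟩ hv

/-! ### Soundness of the deletion rules -/

/-- Every deleted node other than a source is a function of `A` and of deleted nodes that precede
it in the topological order, or an estimate of a deleted source. -/
def Supported (N : Network V E S) (A D : Set N.Node) : Prop :=
  ∀ v ∈ D, v ∉ Set.range (Node.source (N := N)) →
    (∀ u, N.FEdge u v → u ∈ A ∪ D) ∨ ∃ s i, v = Node.estimate s i ∧ Node.source s ∈ D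

namespace IsConstructionB

variable [Fintype E] [Fintype S]

variable {h : Set N.Node → ℝ}

theorem mem_of_parents (hB : N.IsConstructionB h) (hh : IsPolymatroid h) {v : N.Node}
    {T : Set N.Node} (hv : ∀ u, N.FEdge u v → u ∈ polyClosure h T) : v ∈ polyClosure h T :=
  hh.polyClosure_trans hv (hh.condEntropy_eq_zero_iff.1 (hB.localDependence v) rfl)

theorem source_mem (hB : N.IsConstructionB h) (hh : IsPolymatroid h) {s : S}
    {i : {i // i ∈ N.b s}} {T : Set N.Node} (hv : Node.estimate s i ∈ polyClosure h T) :
    Node.source s ∈ polyClosure h T :=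
  hh.polyClosure_trans (Set.singleton_subset_iff.2 hv)
    (hh.condEntropy_eq_zero_iff.1 (hB.source_of_estimate s i) rfl)

theorem estimate_mem (hB : N.IsConstructionB h) (hh : IsPolymatroid h) {s : S}
    {i : {i // i ∈ N.b s}} {T : Set N.Node} (hv : Node.source s ∈ polyClosure h T) :
    Node.estimate s i ∈ polyClosure h T :=
  hh.polyClosure_trans (Set.singleton_subset_iff.2 hv)
    (hh.condEntropy_eq_zero_iff.1 (hB.estimate_of_source s i) rfl)

/-- A source that is separated from one of its estimates is a function of `A`. -/
theorem source_mem_of_not_linked (hB : N.IsConstructionB h) (hh : IsPolymatroid h)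
    {A D : Set N.Node} (hD : D ⊆ polyClosure h A) (hsup : N.Supported A D) {s : S}
    {i : {i // i ∈ N.b s}} (hl : ¬ N.Linked A D s i) : Node.source s ∈ polyClosure h A := by
  by_cases hsD : Node.source s ∈ D
  · exact hD hsD
  by_cases hiD : Node.estimate s i ∈ D
  · exact hB.source_mem hh (hD hiD)
  obtain ⟨r, hr⟩ := N.exists_rank
  let T : Set N.Node := {Node.source s, Node.estimate s i} ∪ A
  let G : N.Node → N.Node → Prop := fun u v => N.BarEdge A D u v ∧
    u ∈ N.ancestral A D T ∧ v ∈ N.ancestral A D T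
  let K : Set N.Node := {v | Relation.EqvGen G (Node.source s) v}
  have hiK : Node.estimate s i ∉ K := fun hk => hl ⟨hsD, hiD, hk⟩
  have hTanc : ∀ t ∈ T, t ∉ D → t ∈ N.ancestral A D T := fun t ht htD =>
    ⟨htD, t, ht, htD, Relation.ReflTransGen.refl⟩
  -- `P0` and `R0` are the sources inside and outside the component `K`, each with the deleted
  -- sources `Z0` adjoined.
  let KS : Set S := {t | Node.source t ∈ K}
  let QS : Set S := {t | Node.source t ∈ D}
  let P0 : Set N.Node := Node.source '' KS ∪ Node.source '' QS
  let R0 : Set N.Node := Node.source '' KSᶜ ∪ Node.source '' QS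
  let Z0 : Set N.Node := Node.source '' QS
  let Aᵣ : ℕ → Set N.Node := fun n => {a | a ∈ A ∧ r a < n}
  have hAmono : ∀ {m n}, m ≤ n → Aᵣ m ⊆ Aᵣ n := fun hmn a ha => ⟨ha.1, ha.2.trans_le hmn⟩
  have hZP : Z0 ⊆ P0 := Set.subset_union_right
  have hZR : Z0 ⊆ R0 := Set.subset_union_right
  have step : ∀ {U : Set N.Node} {m n}, m ≤ n →
      polyClosure h (U ∪ Aᵣ m) ⊆ polyClosure h (U ∪ Aᵣ n) := fun hmn =>
    hh.polyClosure_mono (Set.union_subset_union_right _ (hAmono hmn))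
  have inA : ∀ {U : Set N.Node} {u n}, u ∈ A → r u < n → u ∈ polyClosure h (U ∪ Aᵣ n) :=
    fun hu hn => IsPolymatroid.subset_polyClosure _ (Or.inr ⟨hu, hn⟩)
  -- Only nodes of `A` of smaller rank may be used: `hci` adds the nodes of `A` by rank, and a node
  -- must be determined before it is added. `Supported` makes this possible.
  have hdel : ∀ n, ∀ v ∈ D, r v = n → v ∈ polyClosure h (Z0 ∪ Aᵣ n) := by
    intro n
    induction n using Nat.strong_induction_on with
    | _ n ih =>
      intro v hv hn
      by_cases hsrc : v ∈ Set.range (Node.source (N := N))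
      · obtain ⟨t, rfl⟩ := hsrc
        exact IsPolymatroid.subset_polyClosure _ (Or.inl ⟨t, hv, rfl⟩)
      rcases hsup v hv hsrc with hpar | ⟨t, j, rfl, ht⟩
      · refine hB.mem_of_parents hh fun u hu => ?_
        have hlt : r u < n := hn ▸ hr u v hu hsrc
        rcases hpar u hu with huA | huD
        · exact inA huA hlt
        · exact step hlt.le (ih _ hlt u huD rfl)
      · exact hB.estimate_mem hh (IsPolymatroid.subset_polyClosure _ (Or.inl ⟨t, ht, rfl⟩))
  -- A parent outside `A` and `D` is again in the ancestral graph and in the same component, so the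
  -- sides never mix.
  have hanc : ∀ n, ∀ v ∈ N.ancestral A D T, r v = n →
      (v ∈ K → v ∈ polyClosure h (P0 ∪ Aᵣ n)) ∧ (v ∉ K → v ∈ polyClosure h (R0 ∪ Aᵣ n)) := by
    intro n
    induction n using Nat.strong_induction_on with
    | _ n ih =>
      intro v hv hn
      by_cases hsrc : v ∈ Set.range (Node.source (N := N))
      · obtain ⟨t, rfl⟩ := hsrc
        exact ⟨fun hk => IsPolymatroid.subset_polyClosure _ (Or.inl (Or.inl ⟨t, hk, rfl⟩)),
          fun hk => IsPolymatroid.subset_polyClosure _ (Or.inl (Or.inl ⟨t, hk, rfl⟩))⟩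
      have hpar : ∀ u, N.FEdge u v → u ∉ A → u ∉ D →
          u ∈ N.ancestral A D T ∧ (u ∈ K ↔ v ∈ K) := by
        intro u hu huA huD
        have hbar : N.BarEdge A D u v := ⟨⟨hu, huA, huD, hv.1⟩, hsrc⟩
        obtain ⟨-, t, ht, htD, hp⟩ := id hv
        have hua : u ∈ N.ancestral A D T := ⟨huD, t, ht, htD, hp.head hbar⟩
        have huv : Relation.EqvGen G u v := .rel _ _ ⟨hbar, hua, hv⟩
        exact ⟨hua, fun hk => hk.trans _ _ _ huv, fun hk => hk.trans _ _ _ (huv.symm _ _)⟩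
      constructor
      · refine fun hk => hB.mem_of_parents hh fun u hu => ?_
        have hlt : r u < n := hn ▸ hr u v hu hsrc
        by_cases huA : u ∈ A
        · exact inA huA hlt
        refine step hlt.le ?_
        by_cases huD : u ∈ D
        · exact hh.polyClosure_mono (Set.union_subset_union_left _ hZP) (hdel _ u huD rfl)
        · obtain ⟨hua, hiff⟩ := hpar u hu huA huD
          exact (ih _ hlt u hua rfl).1 (hiff.2 hk)
      · refine fun hk => hB.mem_of_parents hh fun u hu => ?_
        have hlt : r u < n := hn ▸ hr u v hu hsrc
        by_cases huA : u ∈ A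
        · exact inA huA hlt
        refine step hlt.le ?_
        by_cases huD : u ∈ D
        · exact hh.polyClosure_mono (Set.union_subset_union_left _ hZR) (hdel _ u huD rfl)
        · obtain ⟨hua, hiff⟩ := hpar u hu huA huD
          exact (ih _ hlt u hua rfl).2 fun k => hk (hiff.1 k)
  have hci : ∀ n, h (P0 ∪ Aᵣ n) + h (R0 ∪ Aᵣ n) ≤
      h ((P0 ∪ Aᵣ n) ∪ (R0 ∪ Aᵣ n)) + h (Z0 ∪ Aᵣ n) := by
    intro n
    induction n with
    | zero =>
      have h0 : Aᵣ 0 = ∅ := by ext; simp [Aᵣ]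
      simp only [h0, Set.union_empty]
      exact hh.condIndep_of_independent _ hB.independent KS QS
    | succ n ih =>
      -- Rank `n` of `A` is split by side. Deleted nodes depend only on `Z0` and earlier nodes of
      -- `A`, so they may go to either side.
      let BP : Set N.Node := {a | a ∈ A ∧ r a = n ∧ (a ∈ D ∨ a ∈ K)}
      let BR : Set N.Node := {a | a ∈ A ∧ r a = n ∧ a ∉ D ∧ a ∉ K}
      have hsplit : ∀ U : Set N.Node, U ∪ Aᵣ (n + 1) = ((U ∪ Aᵣ n) ∪ BP) ∪ BR := by
        intro U
        ext x
        simp only [Aᵣ, BP, BR, Set.mem_union, Set.mem_ofPred_eq, Nat.lt_succ_iff_lt_or_eq]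
        tauto
      have hBP : BP ⊆ polyClosure h (P0 ∪ Aᵣ n) := by
        rintro a ⟨haA, hn, hDK⟩
        by_cases haD : a ∈ D
        · exact hh.polyClosure_mono (Set.union_subset_union_left _ hZP) (hdel n a haD hn)
        · exact (hanc n a (hTanc a (Or.inr haA) haD) hn).1 (hDK.resolve_left haD)
      have hBR : BR ⊆ polyClosure h (R0 ∪ Aᵣ n ∪ BP) := by
        rintro a ⟨haA, hn, haD, haK⟩
        exact hh.polyClosure_mono Set.subset_union_left
          ((hanc n a (hTanc a (Or.inr haA) haD) hn).2 haK)
      have h1 := hh.condIndep_union (Set.union_subset_union_left _ hZR) ih hBP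
      -- Exchange the two sides, so that `condIndep_union` also absorbs `BR`.
      rw [add_comm, Set.union_comm (P0 ∪ Aᵣ n ∪ BP)] at h1
      have h2 := hh.condIndep_union
        (Set.union_subset_union_left _ (Set.union_subset_union_left _ hZP)) h1 hBR
      rw [add_comm, Set.union_comm (R0 ∪ Aᵣ n ∪ BP ∪ BR)] at h2
      rw [hsplit, hsplit, hsplit]
      exact h2
  cases nonempty_fintype N.Node
  set n : ℕ := (∑ v, r v) + 1
  have hn : ∀ v, r v < n := fun v => Nat.lt_succ_of_le
    (Finset.single_le_sum (f := r) (fun _ _ => Nat.zero_le _) (Finset.mem_univ v))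
  have hsP : Node.source s ∈ P0 ∪ Aᵣ n := Or.inl (Or.inl ⟨s, Relation.EqvGen.refl _, rfl⟩)
  have hsR : Node.source s ∈ polyClosure h (R0 ∪ Aᵣ n) := by
    refine hB.source_mem (i := i) hh (step (hn (Node.estimate s i)).le ?_)
    exact (hanc _ _ (hTanc _ (Or.inl (Or.inr rfl)) hiD) rfl).2 hiK
  refine hh.polyClosure_trans ?_ (hh.mem_polyClosure_of_condIndep
    (Set.union_subset_union_left _ hZP) (Set.union_subset_union_left _ hZR) (hci n) hsP hsR)
  rintro v (⟨t, ht, rfl⟩ | hv)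
  · exact hD ht
  · exact IsPolymatroid.subset_polyClosure _ hv.1

/-- Induction on the rank. Sources in `F` need separate treatment, as edges into them do not respect
the rank; no member of `F` uses such a source as a parent unless it is in `A ∪ D`. -/
theorem subset_polyClosure_of_parents (hB : N.IsConstructionB h) (hh : IsPolymatroid h)
    {A D F : Set N.Node} (hD : D ⊆ polyClosure h A)
    (hF : ∀ v ∈ F, ∀ u, N.FEdge u v →
      u ∈ A ∪ D ∨ u ∈ F ∧ u ∉ Set.range (Node.source (N := N))) :
    F ⊆ polyClosure h A := by
  obtain ⟨r, hr⟩ := N.exists_rank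
  have hns : ∀ n, ∀ v ∈ F, v ∉ Set.range (Node.source (N := N)) → r v = n →
      v ∈ polyClosure h A := by
    intro n
    induction n using Nat.strong_induction_on with
    | _ n ih =>
      intro v hv hsrc hn
      refine hB.mem_of_parents hh fun u hu => ?_
      rcases hF v hv u hu with (huA | huD) | ⟨huF, hus⟩
      · exact IsPolymatroid.subset_polyClosure _ huA
      · exact hD huD
      · exact ih _ (hn ▸ hr u v hu hsrc) u huF hus rfl
  intro v hv
  refine hB.mem_of_parents hh fun u hu => ?_
  rcases hF v hv u hu with (huA | huD) | ⟨huF, hus⟩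
  · exact IsPolymatroid.subset_polyClosure _ huA
  · exact hD huD
  · exact hns _ u huF hus rfl

/-- Rule (1) preserves the invariant, provided the ancestors are deleted as well. -/
theorem exists_supported_of_noSource (hB : N.IsConstructionB h) (hh : IsPolymatroid h)
    {A D : Set N.Node} (hD : D ⊆ polyClosure h A) (hsup : N.Supported A D) {v : N.Node}
    (hv : ∀ s, ¬ Relation.TransGen (N.StarEdge A D) (Node.source s) v) :
    ∃ D', insert v D ⊆ D' ∧ D' ⊆ polyClosure h A ∧ N.Supported A D' := by
  by_cases hvD : v ∈ D
  · exact ⟨D, Set.insert_subset hvD subset_rfl, hD, hsup⟩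
  -- All surviving ancestors of `v` go together with `v`. Only `v` itself can be a source here.
  let F : Set N.Node := {u | u ∉ D ∧ Relation.ReflTransGen (N.StarEdge A D) u v}
  have hF : ∀ w ∈ F, ∀ u, N.FEdge u w →
      u ∈ A ∪ D ∨ u ∈ F ∧ u ∉ Set.range (Node.source (N := N)) := by
    rintro w ⟨hwD, hw⟩ u hu
    by_cases huA : u ∈ A
    · exact Or.inl (Or.inl huA)
    by_cases huD : u ∈ D
    · exact Or.inl (Or.inr huD)
    have huw : N.StarEdge A D u w := ⟨hu, huA, huD, hwD⟩
    refine Or.inr ⟨⟨huD, hw.head huw⟩, ?_⟩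
    rintro ⟨s, rfl⟩
    exact hv s (Relation.TransGen.head' huw hw)
  refine ⟨D ∪ F, Set.insert_subset (Or.inr ⟨hvD, .refl⟩) Set.subset_union_left,
    Set.union_subset hD (hB.subset_polyClosure_of_parents hh hD hF), ?_⟩
  rintro w (hw | hw) hsrc
  · rcases hsup w hw hsrc with hp | ⟨s, i, rfl, hs⟩
    · exact Or.inl fun u hu => (hp u hu).imp_right Or.inl
    · exact Or.inr ⟨s, i, rfl, Or.inl hs⟩
  · refine Or.inl fun u hu => ?_
    rcases hF w hw u hu with (k | k) | k
    · exact Or.inl k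
    · exact Or.inr (Or.inl k)
    · exact Or.inr (Or.inr k.1)

/-- The rules are monotone: one that applies at `D` still applies at the larger `D'`. A node without
incoming edges in particular has no source ancestor, so both forms of rule (1) are treated alike. -/
theorem exists_supported_of_deleted (hB : N.IsConstructionB h) (hh : IsPolymatroid h)
    {A D : Set N.Node} (hdel : N.Deleted A D) :
    ∃ D', D ⊆ D' ∧ D' ⊆ polyClosure h A ∧ N.Supported A D' := by
  induction hdel with
  | start => exact ⟨∅, subset_rfl, Set.empty_subset _, fun v hv => hv.elim⟩
  | noIncoming D v _ hv ih =>
    obtain ⟨D', hDD, hcl, hsup⟩ := ih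
    obtain ⟨D'', h1, h2⟩ := hB.exists_supported_of_noSource hh hcl hsup (v := v) fun s hs => by
      obtain ⟨u, -, hu⟩ := Relation.TransGen.tail'_iff.1 hs
      exact hv u (hu.anti hDD)
    exact ⟨D'', (Set.insert_subset_insert hDD).trans h1, h2⟩
  | noSource D v _ hv ih =>
    obtain ⟨D', hDD, hcl, hsup⟩ := ih
    obtain ⟨D'', h1, h2⟩ := hB.exists_supported_of_noSource hh hcl hsup (v := v) fun s hs =>
      hv s (Relation.TransGen.mono (fun _ _ k => StarEdge.anti hDD k) _ _ hs)
    exact ⟨D'', (Set.insert_subset_insert hDD).trans h1, h2⟩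
  | separated D s i _ hl ih =>
    obtain ⟨D', hDD, hcl, hsup⟩ := ih
    have hs := hB.source_mem_of_not_linked hh hcl hsup fun k => hl (k.anti hDD)
    -- Adjoining `Y_s` gives its estimates the second alternative of `Supported`.
    refine ⟨insert (Node.source s) (D' ∪ Set.range (Node.estimate s)),
      (Set.union_subset_union_left _ hDD).trans (Set.subset_insert _ _),
      Set.insert_subset hs (Set.union_subset hcl ?_), ?_⟩
    · rintro _ ⟨j, rfl⟩
      exact hB.estimate_mem hh hs
    · rintro w (rfl | hw | ⟨j, rfl⟩) hsrc
      · exact absurd ⟨s, rfl⟩ hsrc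
      · rcases hsup w hw hsrc with hp | ⟨t, j, rfl, ht⟩
        · exact Or.inl fun u hu => (hp u hu).imp_right fun k => Or.inr (Or.inl k)
        · exact Or.inr ⟨t, j, rfl, Or.inr (Or.inl ht)⟩
      · exact Or.inr ⟨s, j, rfl, Or.inl rfl⟩

theorem condEntropy_eq_zero_of_determines (hB : N.IsConstructionB h) (hh : IsPolymatroid h)
    {A B : Set N.Node} (hAB : N.Determines A B) : condEntropy h B A = 0 := by
  refine hh.condEntropy_eq_zero_iff.2 fun v hv => ?_
  obtain ⟨D, hD, hvD⟩ := hAB hv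
  obtain ⟨D', hDD, hcl, -⟩ := hB.exists_supported_of_deleted hh hD
  exact hcl (hDD hvD)

end IsConstructionB

/-! ### The bounds -/

variable [Fintype S]

/-- The pseudo-variable represented by a node; an estimate represents its source. -/
def Node.toVar : N.Node → S ⊕ E
  | .source s => .inl s
  | .link e => .inr e
  | .estimate s _ => .inl s

theorem _root_.IsPolymatroid.comp_image {X Y : Type*} {h : Set X → ℝ} (hh : IsPolymatroid h)
    (f : Y → X) : IsPolymatroid fun B => h (f '' B) where
  empty := by simpa using hh.empty
  mono A B hBA := hh.mono _ _ (Set.image_mono hBA)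
  submodular A B := by
    have h1 := hh.submodular (f '' A) (f '' B)
    have h2 := hh.mono _ _ (Set.image_inter_subset f A B)
    rw [← Set.image_union] at h1
    linarith

/-- Under `toVar` the parents of `Y_s` all become `Y_s`, and there is one because `b s` is nonempty.
At links and estimates local dependence is `C2` and `C3`. -/
theorem isConstructionB_toVar [Fintype E] {h : Set (S ⊕ E) → ℝ} (hh : IsPolymatroid h) (h1 : N.C1 h)
    (h2 : N.C2 h) (h3 : N.C3 h) :
    N.IsConstructionB fun B => h (Node.toVar '' B) where
  localDependence v := by
    simp only [condEntropy, Set.image_union, Set.image_singleton]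
    rw [← condEntropy, hh.condEntropy_eq_zero_iff, Set.singleton_subset_iff]
    cases v with
    | source s =>
      obtain ⟨i, hi⟩ := N.demanded s
      exact IsPolymatroid.subset_polyClosure _ ⟨.estimate s ⟨i, hi⟩, .identify s _, rfl⟩
    | link e =>
      refine hh.polyClosure_mono ?_ (hh.condEntropy_eq_zero_iff.1 (h2 e) rfl)
      rintro _ (⟨s, hs, rfl⟩ | ⟨f, hf, rfl⟩)
      · exact ⟨.source s, .encodeSource s e hs, rfl⟩
      · exact ⟨.link f, .encodeLink f e hf, rfl⟩
    | estimate s i =>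
      refine hh.polyClosure_mono ?_ (hh.condEntropy_eq_zero_iff.1 (h3 s i.1 i.2) rfl)
      rintro _ ⟨e, he, rfl⟩
      exact ⟨.link e, .decode e s i he, rfl⟩
  source_of_estimate s i := by simp [condEntropy, Node.toVar, Set.image_insert_eq]
  estimate_of_source s i := by simp [condEntropy, Node.toVar, Set.image_insert_eq]
  independent := by
    rw [← Set.range_comp]
    simp only [Set.image_singleton]
    exact h1

/-- The cut set has the same `h` as all variables together, so `h(Y_S) ≤ h(U_A, Y_{Wᶜ}) ≤ ∑ C_e +
h(Y_{Wᶜ})`. -/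
theorem condEntropy_le_sum_of_determines [Fintype E] {C : E → ℝ} {h : Set (S ⊕ E) → ℝ}
    (hh : IsPolymatroid h) (h1 : N.C1 h) (h2 : N.C2 h) (h3 : N.C3 h) (h4 : N.C4 C h)
    (W : Finset S) (A : Finset E) (hA : N.Determines (N.cutNodes A W) Set.univ) :
    condEntropy h (Sum.inl '' (W : Set S)) (Sum.inl '' ((W : Set S)ᶜ)) ≤ ∑ e ∈ A, C e := by
  have k1 := (isConstructionB_toVar hh h1 h2 h3).condEntropy_eq_zero_of_determines
    (hh.comp_image _) hA
  simp only [condEntropy, Set.union_univ, cutNodes, Set.image_union, Set.image_image,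
    Node.toVar] at k1 ⊢
  have k2 := hh.mono (Node.toVar '' (Set.univ : Set N.Node))
    (Sum.inl '' ((W : Set S)ᶜ) ∪ Sum.inl '' (W : Set S)) (by
      rintro _ (⟨s, -, rfl⟩ | ⟨s, -, rfl⟩) <;> exact ⟨.source s, trivial, rfl⟩)
  have k3 := hh.submodular (Sum.inr '' (A : Set E)) (Sum.inl '' ((W : Set S)ᶜ))
  have k4 := hh.mono (Sum.inr '' (A : Set E) ∩ Sum.inl '' ((W : Set S)ᶜ)) ∅
    (Set.empty_subset _)
  have k5 := hh.image_finset_le_sum Sum.inr A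
  have k6 := Finset.sum_le_sum fun e (_ : e ∈ A) => h4 e
  rw [hh.empty] at k4
  linarith

theorem condEntropy_le_minCut [Fintype E] {C : E → ℝ} {h : Set (S ⊕ E) → ℝ}
    (hh : IsPolymatroid h) (h1 : N.C1 h) (h2 : N.C2 h) (h3 : N.C3 h) (h4 : N.C4 C h)
    (W : Finset S) :
    ((condEntropy h (Sum.inl '' (W : Set S)) (Sum.inl '' ((W : Set S)ᶜ)) : ℝ) : EReal)
      ≤ N.minCut C W :=
  le_iInf₂ fun A hA => EReal.coe_le_coe_iff.2 <|
    condEntropy_le_sum_of_determines hh h1 h2 h3 h4 W A (Set.sdiff_eq_empty.1 hA.2.1)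

theorem condEntropy_compl_eq_sum {h : Set (S ⊕ E) → ℝ} (hh : IsPolymatroid h) (h1 : N.C1 h)
    (W : Finset S) :
    condEntropy h (Sum.inl '' (W : Set S)) (Sum.inl '' ((W : Set S)ᶜ)) =
      ∑ s ∈ W, h {Sum.inl s} := by
  classical
  have k := hh.image_finset_eq_sum _ h1 Wᶜ
  rw [Finset.coe_compl] at k
  rw [condEntropy, ← Set.image_union, Set.compl_union_self, Set.image_univ, k, h1,
    ← Finset.sum_add_sum_compl W]
  ring

theorem sum_le_minCut [Fintype E] {C : E → ℝ} {h : Set (S ⊕ E) → ℝ}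
    (hh : IsPolymatroid h) (h1 : N.C1 h) (h2 : N.C2 h) (h3 : N.C3 h) (h4 : N.C4 C h)
    (W : Finset S) : ((∑ s ∈ W, h {Sum.inl s} : ℝ) : EReal) ≤ N.minCut C W := by
  rw [← condEntropy_compl_eq_sum hh h1]
  exact condEntropy_le_minCut hh h1 h2 h3 h4 W

end Network

theorem mainTheorem3 {V E S : Type*} [Fintype E] [Fintype S] (N : Network V E S) :
    (∀ h : Set N.Node → ℝ, IsPolymatroid h → N.IsConstructionB h →
      ∀ A B : Set N.Node, N.Determines A B → condEntropy h B A = 0) ∧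
    (∀ C : E → ℝ, ∀ h : Set (S ⊕ E) → ℝ,
      IsPolymatroid h → N.C1 h → N.C2 h → N.C3 h → N.C4 C h →
      ∀ W : Finset S,
        ((condEntropy h (Sum.inl '' (W : Set S)) (Sum.inl '' ((W : Set S)ᶜ)) : ℝ) : EReal)
            ≤ N.minCut C W ∧
        ((∑ s ∈ W, h {Sum.inl s} : ℝ) : EReal) ≤ N.minCut C W) ∧
    (∀ C : E → ℝ, N.lpRegion C ⊆ N.regionPerp C) := by
  refine ⟨fun h hh hB A B hAB => hB.condEntropy_eq_zero_of_determines hh hAB,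
    fun C h hh h1 h2 h3 h4 W => ⟨Network.condEntropy_le_minCut hh h1 h2 h3 h4 W,
      Network.sum_le_minCut hh h1 h2 h3 h4 W⟩, ?_⟩
  rintro C R ⟨hR, h, hh, h1, h2, h3, h4, hle⟩
  exact ⟨hR, fun W => (EReal.coe_le_coe_iff.2 (Finset.sum_le_sum fun s _ => hle s)).trans
    (Network.sum_le_minCut hh h1 h2 h3 h4 W)⟩
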